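/- Let $H$ be a separable infinite-dimensional complex Hilbert space and let $B(H)$ be the algebra of bounded linear operators on $H$. Let $B_{sk}(H)=\{a\in B(H): a^*=-a\}$, a real Lie algebra with bracket $[a,b]=ab-ba$, and let $\mathcal{K}_{sk}(H)$ be its Lie subalgebra of compact skew-adjoint operators. Let $\Omega$ be a topological space, and let $F(\Omega,B_{sk}(H))$ be the real Lie algebra of all maps $\Omega\to B_{sk}(H)$ with the pointwise bracket. Let $\mathcal{A}$ be $B_{sk}(H)$ or $\mathcal{K}_{sk}(H)$, and let $\mathcal{L}\subseteq F(\Omega,B_{sk}(H))$ be either the Lie subalgebra $F(\Omega,\mathcal{A})$ of all maps $\Omega\to\mathcal{A}$ or the Lie subalgebra $C(\Omega,\mathcal{A})$ of all norm-continuous maps $\Omega\to\mathcal{A}$. A derivation $D:\mathcal{L}\to\mathcal{L}$ is called spatial if there is $a\in F(\Omega,B_{sk}(H))$ with $D(x)=[a,x]$ for all $x\in\mathcal{L}$. A linear map $\nabla:\mathcal{L}\to\mathcal{L}$ is called a local spatial derivation implemented by elements of $F(\Omega,B_{sk}(H))$ if for every $x\in\mathcal{L}$ there is a spatial derivation $D$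 on $\mathcal{L}$ (depending on $x$) with $\nabla(x)=D(x)$. For $a\in\mathcal{A}$ let $\psi(a)\in\mathcal{L}$ be the constant map with value $a$, and for $t\in\Omega$ let $\phi_t(x)=x(t)$. Theorem. Let $\nabla$ be a local spatial derivation on $\mathcal{L}$ implemented by elements of $F(\Omega,B_{sk}(H))$ such that for every $t\in\Omega$ the map $\phi_t\nabla\psi:\mathcal{A}\to B_{sk}(H)$, $a\mapsto\nabla(\psi(a))(t)$, is continuous with respect to the topologies induced on $\mathcal{A}$ and $B_{sk}(H)$ by the ultraweak topology of $B(H)$. Then $\nabla$ is a spatial derivation. -/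

import Mathlib

attribute [local instance 100] LieRing.ofAssociativeRing

/-- The real Lie algebra `B_sk(H)` of all skew-adjoint bounded operators on `H`, with the
commutator bracket. -/
def skewOperators (H : Type*) [NormedAddCommGroup H] [InnerProductSpace ℂ H] [CompleteSpace H] :
    LieSubalgebra ℝ (H →L[ℂ] H) where
  carrier := {a | star a = -a}
  zero_mem' := by simp
  add_mem' := by
    intro a b ha hb
    simp only [Set.mem_ofPred_eq] at ha hb ⊢
    rw [star_add, ha, hb, neg_add]
  smul_mem' := by
    intro c a ha
    simp only [Set.mem_ofPred_eq] at ha ⊢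
    rw [star_smul, ha, star_trivial, smul_neg]
  lie_mem' := by
    intro a b ha hb
    simp only [Set.mem_ofPred_eq] at ha hb ⊢
    rw [Ring.lie_def, star_sub, star_mul, star_mul, ha, hb]
    noncomm_ring

/-- The Lie algebra of all skew-adjoint compact operators on `H`, as a Lie subalgebra of
`B_sk(H)`. -/
def compactSkewOperators (H : Type*) [NormedAddCommGroup H] [InnerProductSpace ℂ H]
    [CompleteSpace H] : LieSubalgebra ℝ (skewOperators H) where
  carrier := {a | IsCompactOperator (a : H →L[ℂ] H)}
  zero_mem' := isCompactOperator_zero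
  add_mem' := fun ha hb => IsCompactOperator.add ha hb
  smul_mem' := by
    intro c a ha
    exact IsCompactOperator.smul (S := ℝ) ha c
  lie_mem' := by
    intro a b ha hb
    have h1 : IsCompactOperator ((a : H →L[ℂ] H) ∘ (b : H →L[ℂ] H)) :=
      IsCompactOperator.comp_clm ha (b : H →L[ℂ] H)
    have h2 : IsCompactOperator ((b : H →L[ℂ] H) ∘ (a : H →L[ℂ] H)) :=
      IsCompactOperator.comp_clm hb (a : H →L[ℂ] H)
    exact IsCompactOperator.sub h1 h2

/-- Maps into a Lie ring form a Lie ring with the pointwise bracket `[f, g](t) = [f(t), g(t)]`. -/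
instance mapsLieRing {Ω A : Type*} [LieRing A] : LieRing (Ω → A) where
  bracket f g := fun t => ⁅f t, g t⁆
  add_lie f g h := funext fun t => add_lie (f t) (g t) (h t)
  lie_add f g h := funext fun t => lie_add (f t) (g t) (h t)
  lie_self f := funext fun t => lie_self (f t)
  leibniz_lie f g h := funext fun t => leibniz_lie (f t) (g t) (h t)

/-- Maps into a Lie algebra form a Lie algebra with the pointwise bracket. -/
instance mapsLieAlgebra {R Ω A : Type*} [CommRing R] [LieRing A] [LieAlgebra R A] :
    LieAlgebra R (Ω → A) where
  lie_smul c f g := funext fun t => lie_smul c (f t) (g t)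

/-- `F(Ω, 𝒜)`: all maps from `Ω` to `𝒜`, as a Lie subalgebra of the Lie algebra
`F(Ω, B_sk(H)) = (Ω → B_sk(H))` of all maps with the pointwise bracket. -/
def allMaps {H : Type*} [NormedAddCommGroup H] [InnerProductSpace ℂ H] [CompleteSpace H]
    (Ω : Type*) (𝒜 : LieSubalgebra ℝ (skewOperators H)) :
    LieSubalgebra ℝ (Ω → skewOperators H) where
  carrier := {f | ∀ t, f t ∈ 𝒜}
  zero_mem' := fun _ => 𝒜.zero_mem
  add_mem' := fun hf hg t => 𝒜.add_mem (hf t) (hg t)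
  smul_mem' := fun c _ hf t => 𝒜.smul_mem c (hf t)
  lie_mem' := fun hf hg t => 𝒜.lie_mem (hf t) (hg t)

/-- `C(Ω, 𝒜)`: all (norm-)continuous maps from `Ω` to `𝒜`, as a Lie subalgebra of
`F(Ω, B_sk(H))`. -/
def continuousMaps {H : Type*} [NormedAddCommGroup H] [InnerProductSpace ℂ H] [CompleteSpace H]
    (Ω : Type*) [TopologicalSpace Ω] (𝒜 : LieSubalgebra ℝ (skewOperators H)) :
    LieSubalgebra ℝ (Ω → skewOperators H) where
  carrier := {f | Continuous f ∧ ∀ t, f t ∈ 𝒜}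
  zero_mem' := ⟨continuous_const, fun _ => 𝒜.zero_mem⟩
  add_mem' := by
    rintro f g ⟨hf, hf'⟩ ⟨hg, hg'⟩
    refine ⟨?_, fun t => 𝒜.add_mem (hf' t) (hg' t)⟩
    rw [continuous_induced_rng] at hf hg ⊢
    exact hf.add hg
  smul_mem' := by
    rintro c f ⟨hf, hf'⟩
    refine ⟨?_, fun t => 𝒜.smul_mem c (hf' t)⟩
    rw [continuous_induced_rng] at hf ⊢
    exact hf.const_smul c
  lie_mem' := by
    rintro f g ⟨hf, hf'⟩ ⟨hg, hg'⟩
    refine ⟨?_, fun t => 𝒜.lie_mem (hf' t) (hg' t)⟩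
    rw [continuous_induced_rng] at hf hg ⊢
    exact (hf.mul hg).sub (hg.mul hf)

/-- The ultraweak (σ-weak) topology on `B(H)`: the coarsest topology for which all functionals
`x ↦ ∑ₙ ⟪ξₙ, x ηₙ⟫` with square-summable sequences `ξ`, `η` in `H` are continuous. -/
@[reducible]
noncomputable def ultraweakTopology (H : Type*) [NormedAddCommGroup H] [InnerProductSpace ℂ H] :
    TopologicalSpace (H →L[ℂ] H) :=
  ⨅ (ξ : lp (fun _ : ℕ => H) 2) (η : lp (fun _ : ℕ => H) 2),
    TopologicalSpace.induced (fun x : H →L[ℂ] H => ∑' n, inner ℂ (ξ n) (x (η n))) inferInstance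

/-- A derivation `D` on a Lie subalgebra `B` of `A` is spatial if it is implemented by an element
of `A`: `D(x) = [a, x]` for all `x ∈ B`. -/
def IsSpatialDerivation {R A : Type*} [CommRing R] [LieRing A] [LieAlgebra R A]
    {B : LieSubalgebra R A} (D : LieDerivation R B B) : Prop :=
  ∃ a : A, ∀ x : B, (D x : A) = ⁅a, (x : A)⁆

/-- A linear map `T` on a Lie subalgebra `B` of `A` is a local spatial derivation implemented by
elements of `A` if at every `x ∈ B` it agrees with some spatial derivation on `B`. -/
def IsLocalSpatialDerivation {R A : Type*} [CommRing R] [LieRing A] [LieAlgebra R A]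
    {B : LieSubalgebra R A} (T : B →ₗ[R] B) : Prop :=
  ∀ x : B, ∃ D : LieDerivation R B B, IsSpatialDerivation D ∧ T x = D x

/-- `ψ`: the constant map `Ω → B_sk(H)` with value `a`. -/
def constMap {H : Type*} [NormedAddCommGroup H] [InnerProductSpace ℂ H] [CompleteSpace H]
    (Ω : Type*) (a : skewOperators H) : Ω → skewOperators H :=
  fun _ => a

theorem constMap_mem_allMaps {H : Type*} [NormedAddCommGroup H] [InnerProductSpace ℂ H]
    [CompleteSpace H] (Ω : Type*) (𝒜 : LieSubalgebra ℝ (skewOperators H)) (a : 𝒜) :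
    constMap Ω (a : skewOperators H) ∈ allMaps Ω 𝒜 :=
  fun _ => a.2

theorem constMap_mem_continuousMaps {H : Type*} [NormedAddCommGroup H] [InnerProductSpace ℂ H]
    [CompleteSpace H] (Ω : Type*) [TopologicalSpace Ω] (𝒜 : LieSubalgebra ℝ (skewOperators H))
    (a : 𝒜) : constMap Ω (a : skewOperators H) ∈ continuousMaps Ω 𝒜 :=
  ⟨continuous_const, fun _ => a.2⟩

theorem constMap_mem {H : Type*} [NormedAddCommGroup H] [InnerProductSpace ℂ H]
    [CompleteSpace H] {Ω : Type*} [TopologicalSpace Ω] {𝒜 : LieSubalgebra ℝ (skewOperators H)}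
    {L : LieSubalgebra ℝ (Ω → skewOperators H)}
    (hL : L = allMaps Ω 𝒜 ∨ L = continuousMaps Ω 𝒜) (a : 𝒜) :
    constMap Ω (a : skewOperators H) ∈ L := by
  rcases hL with rfl | rfl
  · exact constMap_mem_allMaps Ω 𝒜 a
  · exact constMap_mem_continuousMaps Ω 𝒜 a

/-- The map `φ_t ∘ T ∘ ψ : 𝒜 → B_sk(H)`, `a ↦ T(ψ(a))(t)`, where `φ_t` is evaluation at `t`. -/
noncomputable def evalNablaConst {H : Type*} [NormedAddCommGroup H] [InnerProductSpace ℂ H]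
    [CompleteSpace H] {Ω : Type*} [TopologicalSpace Ω] {𝒜 : LieSubalgebra ℝ (skewOperators H)}
    {L : LieSubalgebra ℝ (Ω → skewOperators H)}
    (hL : L = allMaps Ω 𝒜 ∨ L = continuousMaps Ω 𝒜) (T : L →ₗ[ℝ] L) (t : Ω) (a : 𝒜) :
    skewOperators H :=
  (T ⟨constMap Ω (a : skewOperators H), constMap_mem hL a⟩ : Ω → skewOperators H) t

/-- A map from a Lie subalgebra `𝒜` of `B_sk(H)` to `B_sk(H)` is ultraweakly continuous if it is
continuous for the topologies that the ultraweak topology of `B(H)` induces on both. -/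
def IsUltraweaklyContinuous {H : Type*} [NormedAddCommGroup H] [InnerProductSpace ℂ H]
    [CompleteSpace H] {𝒜 : LieSubalgebra ℝ (skewOperators H)} (f : 𝒜 → skewOperators H) : Prop :=
  @Continuous 𝒜 (skewOperators H)
    (TopologicalSpace.induced (fun a : 𝒜 => ((a : skewOperators H) : H →L[ℂ] H))
      (ultraweakTopology H))
    (TopologicalSpace.induced (fun a : skewOperators H => (a : H →L[ℂ] H)) (ultraweakTopology H))
    f

/-! If c is the constant map with value x(t), then x - c vanishes at t, hence so does ∇(x - c). At
each fixed t, therefore, only a linear map τ : 𝒜 → B_sk(H) matters, agreeing at each point with the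
commutator by some skew-adjoint operator.

Write S(x, y) = i(x ⊗ y* + y ⊗ x*) and R(x, y) = τ(S(x, y)). Locality at multiples of projections
onto lines and planes gives the fields `diag` and `orth`. After subtracting an inner derivation,
R(e, e) = 0 for some unit vector e. With uξ = -i R(e, ξ)e, these conditions force R(e, ξ) = S(uξ, e)
for ξ ⊥ e and R(ξ, ξ) = 2 S(uξ, ξ) for all ξ; moreover u is complex linear with Re⟨uξ, ξ⟩ = 0. Hence
u is bounded and skew-adjoint, and polarization gives R(x, y) = [u, S(x, y)]
(`exists_skew_implementer`).

Finally, every a in 𝒜 is the ultraweak limit of the finite sums of operators S(x, y) in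
`skewTruncation`, so continuity carries the formula to all of 𝒜
(`exists_implementer_of_continuous`). -/

open InnerProductSpace Complex

/-! ### Rank-two skew operators and local skew forms -/

section skewForm

variable {H : Type*} [NormedAddCommGroup H] [InnerProductSpace ℂ H]

/-- The skew-adjoint operator `i (x ⊗ y* + y ⊗ x*)`. -/
noncomputable def skewRankTwo (x y : H) : H →L[ℂ] H :=
  I • (rankOne ℂ x y + rankOne ℂ y x)

theorem skewRankTwo_apply (x y z : H) :
    skewRankTwo x y z = I • (inner ℂ y z • x + inner ℂ x z • y) := by
  simp [skewRankTwo]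

theorem skewRankTwo_inner (x y z w : H) :
    inner ℂ (skewRankTwo x y z) w = -inner ℂ z (skewRankTwo x y w) := by
  simp only [skewRankTwo_apply, inner_smul_left, inner_smul_right, inner_add_left,
    inner_add_right, inner_conj_symm, conj_I]
  ring

/-- The properties of the map `(x, y) ↦ τ (i (x ⊗ y* + y ⊗ x*))` for a local derivation `τ` of a
Lie algebra of skew-adjoint operators. -/
structure IsLocalSkewForm (R : H →ₗ[ℝ] H →ₗ[ℝ] (H →L[ℂ] H)) : Prop where
  symm : ∀ x y, R x y = R y x
  rot : ∀ x y, R (I • x) y = -R x (I • y)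
  skew : ∀ x y z w, inner ℂ (R x y z) w = -inner ℂ z (R x y w)
  diag : ∀ x, (‖x‖ ^ 2) • R x x = R x x * rankOne ℂ x x + rankOne ℂ x x * R x x
  orth : ∀ x y : H, inner ℂ x y = 0 →
    ((‖y‖ ^ 2 : ℝ) : ℂ) * inner ℂ y (R x x x) + ((‖x‖ ^ 2 : ℝ) : ℂ) * inner ℂ y (R y y x) = 0

namespace IsLocalSkewForm

variable {R : H →ₗ[ℝ] H →ₗ[ℝ] (H →L[ℂ] H)}

/-- `diag` at e + sξ is a polynomial identity in the real number s; these are its coefficients of s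
and s². The values s = 1, -1, 2, together with `diag` at ξ for the s⁴ term, suffice to isolate them.
-/
theorem peirce (hR : IsLocalSkewForm R) {e ξ : H} (he : ‖e‖ = 1) (h0 : R e e = 0)
    (hξ : inner ℂ e ξ = 0) :
    R e ξ = R e ξ * rankOne ℂ e e + rankOne ℂ e e * R e ξ ∧
    R ξ ξ = (2 : ℝ) • (R e ξ * (rankOne ℂ e ξ + rankOne ℂ ξ e)
        + (rankOne ℂ e ξ + rankOne ℂ ξ e) * R e ξ)
      + (R ξ ξ * rankOne ℂ e e + rankOne ℂ e e * R ξ ξ) := by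
  have hr : RCLike.re (inner ℂ e ξ) = 0 := by simp [hξ]
  have n1 : ‖e + ξ‖ ^ 2 = 1 + ‖ξ‖ ^ 2 := by rw [norm_add_sq (𝕜 := ℂ), hr, he]; ring
  have n2 : ‖e - ξ‖ ^ 2 = 1 + ‖ξ‖ ^ 2 := by rw [norm_sub_sq (𝕜 := ℂ), hr, he]; ring
  have n3 : ‖e + (ξ + ξ)‖ ^ 2 = 1 + 4 * ‖ξ‖ ^ 2 := by
    rw [norm_add_sq (𝕜 := ℂ), inner_add_right, map_add, hr, he, ← two_smul ℝ ξ, norm_smul]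
    norm_num
    ring
  have h1 := hR.diag (e + ξ)
  have h2 := hR.diag (e - ξ)
  have h3 := hR.diag (e + (ξ + ξ))
  have h4 := hR.diag ξ
  rw [n1] at h1
  rw [n2] at h2
  rw [n3] at h3
  simp only [map_add, map_sub, LinearMap.add_apply, LinearMap.sub_apply, add_apply, sub_apply,
    h0, hR.symm ξ e, mul_add, add_mul, mul_sub, sub_mul, zero_mul, mul_zero] at h1 h2 h3
  simp only [mul_add, add_mul]
  have hS : R ξ ξ = (2 : ℝ) • (R e ξ * rankOne ℂ e ξ + R e ξ * rankOne ℂ ξ e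
      + (rankOne ℂ e ξ * R e ξ + rankOne ℂ ξ e * R e ξ))
      + (R ξ ξ * rankOne ℂ e e + rankOne ℂ e e * R ξ ξ) := by
    linear_combination (norm := module) (1 / 2 : ℝ) • h1 + (1 / 2 : ℝ) • h2 - h4
  refine ⟨?_, hS⟩
  linear_combination (norm := module) (1 / 3 : ℝ) • h1 - (1 / 3 : ℝ) • h2 - (1 / 12 : ℝ) • h3
    + (1 / 3 : ℝ) • hS + (4 / 3 : ℝ) • h4

variable {R : H →ₗ[ℝ] H →ₗ[ℝ] (H →L[ℂ] H)}

/-- The implementing operator `ξ ↦ -i R(e, ξ) e` of a form that vanishes at the unit vector `e`. -/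
noncomputable def implementer (R : H →ₗ[ℝ] H →ₗ[ℝ] (H →L[ℂ] H)) (e : H) : H →ₗ[ℝ] H where
  toFun ξ := -(I • R e ξ e)
  map_add' x y := by simp [add_comm]
  map_smul' c x := by simp [smul_comm I c]

theorem implementer_apply (e ξ : H) : implementer R e ξ = -(I • R e ξ e) := rfl

theorem apply_self_eq (e ξ : H) : R e ξ e = I • implementer R e ξ := by
  rw [implementer_apply, smul_neg, smul_smul, I_mul_I, neg_one_smul, neg_neg]

/-! ### The form on the orthogonal complement of e -/

section orthogonal

variable {e ξ : H}

theorem inner_implementer (hR : IsLocalSkewForm R) (he : ‖e‖ = 1) (h0 : R e e = 0)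
    (hξ : inner ℂ e ξ = 0) : inner ℂ e (implementer R e ξ) = 0 := by
  have h := congrArg (fun A => inner ℂ e (A e)) (hR.peirce he h0 hξ).1
  simp only [add_apply, mul_apply_eq_comp, rankOne_apply, inner_add_right,
    map_smul, inner_smul_right, inner_self_eq_norm_sq_to_K (𝕜 := ℂ) e, he] at h
  rw [implementer_apply, inner_neg_right, inner_smul_right]
  simp at h
  simp [h]

/-- As R(e, e) = 0, `orth` kills the ξ-component of R(ξ, ξ)e; `diag` at ξ, evaluated at e, says that
this is the only possible component. -/
theorem diag_apply_eq_zero (hR : IsLocalSkewForm R) (he : ‖e‖ = 1) (h0 : R e e = 0)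
    (hξ : inner ℂ e ξ = 0) : R ξ ξ e = 0 := by
  rcases eq_or_ne ξ 0 with rfl | hne
  · simp
  have h1 := hR.orth e ξ hξ
  have h2 := DFunLike.congr_fun (hR.diag ξ) e
  have hξ' : inner ℂ ξ e = 0 := by rw [← inner_conj_symm, hξ, map_zero]
  simp only [h0, zero_apply, inner_zero_right, mul_zero, zero_add, he] at h1
  have h1' : inner ℂ ξ (R ξ ξ e) = 0 := by simpa using h1
  have h3 : (‖ξ‖ ^ 2) • R ξ ξ e = 0 := by
    simpa [hξ', h1'] using h2
  simpa [hne] using h3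

theorem eq_skewRankTwo (hR : IsLocalSkewForm R) (he : ‖e‖ = 1) (h0 : R e e = 0)
    (hξ : inner ℂ e ξ = 0) : R e ξ = skewRankTwo (implementer R e ξ) e := by
  ext z
  have h := DFunLike.congr_fun (hR.peirce he h0 hξ).1 z
  simp only [add_apply, mul_apply_eq_comp, rankOne_apply, map_smul] at h
  have h2 : inner ℂ e (R e ξ z) = I * inner ℂ (implementer R e ξ) z := by
    have := hR.skew e ξ e z
    rw [apply_self_eq, inner_smul_left, conj_I] at this
    linear_combination this
  rw [h, h2, skewRankTwo_apply, apply_self_eq]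
  module

theorem diag_eq_skewRankTwo (hR : IsLocalSkewForm R) (he : ‖e‖ = 1) (h0 : R e e = 0)
    (hξ : inner ℂ e ξ = 0) :
    R ξ ξ = (2 : ℝ) • skewRankTwo (implementer R e ξ) ξ ∧
      (inner ℂ (implementer R e ξ) ξ).re = 0 := by
  have hu := hR.inner_implementer he h0 hξ
  have hS := hR.diag_apply_eq_zero he h0 hξ
  have hRe := hR.eq_skewRankTwo he h0 hξ
  set u := implementer R e ξ
  have hξ' : inner ℂ ξ e = 0 := by rw [← inner_conj_symm, hξ, map_zero]
  have hu' : inner ℂ u e = 0 := by rw [← inner_conj_symm, hu, map_zero]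
  have hee : inner ℂ e e = (1 : ℂ) := by rw [inner_self_eq_norm_sq_to_K, he]; simp
  have hSz : ∀ z, inner ℂ e (R ξ ξ z) = 0 := by
    intro z
    have := hR.skew ξ ξ e z
    rw [hS, inner_zero_left] at this
    linear_combination this
  have key : ∀ z, R ξ ξ z = (2 * I : ℂ) • (inner ℂ ξ z • u + inner ℂ u z • ξ
      + (inner ℂ e z * (inner ℂ u ξ + inner ℂ ξ u)) • e) := by
    intro z
    have h := DFunLike.congr_fun (hR.peirce he h0 hξ).2 z
    rw [hRe] at h
    simp only [add_apply, smul_apply, mul_apply_eq_comp, rankOne_apply, map_smul,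
      map_add, hS, hSz, skewRankTwo_apply, hu, hξ, hξ', hu',
      hee] at h
    rw [h, ← Complex.coe_smul]
    push_cast
    module
  -- At z = e only the coefficient of e remains, while the left side vanishes.
  have hre : inner ℂ u ξ + inner ℂ ξ u = 0 := by
    have h := key e
    rw [hS, hξ', hu', hee] at h
    have hne : e ≠ 0 := by rintro rfl; simp at he
    simpa [hne] using h.symm
  constructor
  · ext z
    rw [key, hre, smul_apply, skewRankTwo_apply, ← Complex.coe_smul]
    push_cast
    module
  · rw [← inner_conj_symm ξ u] at hre
    have := congrArg re hre
    simp only [add_re, conj_re, zero_re] at this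
    linarith

/-- R(iξ, iξ) = R(ξ, ξ) gives S(uξ, ξ) = S(u(iξ), iξ) = -S(i u(iξ), ξ), so S(uξ + i u(iξ), ξ) = 0,
which leaves only imaginary multiples of ξ. -/
theorem exists_implementer_add (hR : IsLocalSkewForm R) (he : ‖e‖ = 1) (h0 : R e e = 0)
    (hξ : inner ℂ e ξ = 0) :
    ∃ r : ℝ, implementer R e ξ + I • implementer R e (I • ξ) = (I * r) • ξ := by
  rcases eq_or_ne ξ 0 with rfl | hne
  · exact ⟨0, by simp⟩
  have hIξ : inner ℂ e (I • ξ) = 0 := by rw [inner_smul_right, hξ, mul_zero]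
  obtain ⟨h1, h2⟩ := hR.diag_eq_skewRankTwo he h0 hξ
  obtain ⟨h3, h4⟩ := hR.diag_eq_skewRankTwo he h0 hIξ
  have hrot : R (I • ξ) (I • ξ) = R ξ ξ := by
    rw [hR.rot, smul_smul, I_mul_I, neg_one_smul, map_neg, neg_neg]
  rw [hrot, h1] at h3
  have h5 := DFunLike.congr_fun (smul_right_injective _ (two_ne_zero' ℝ) h3) ξ
  simp only [skewRankTwo_apply, inner_smul_left, conj_I] at h5
  replace h5 := smul_right_injective _ I_ne_zero h5
  set u := implementer R e ξ
  set u' := implementer R e (I • ξ)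
  have hn : (inner ℂ ξ ξ : ℂ) = ((‖ξ‖ ^ 2 : ℝ) : ℂ) := by
    rw [inner_self_eq_norm_sq_to_K]; simp
  have hn0 : ((‖ξ‖ ^ 2 : ℝ) : ℂ) ≠ 0 := by
    exact_mod_cast pow_ne_zero 2 (norm_ne_zero_iff.2 hne)
  rw [inner_smul_right, I_mul_re] at h4
  rw [hn] at h5
  have h6 : inner ℂ u ξ = I * (inner ℂ u ξ).im := by
    apply Complex.ext <;> simp [h2]
  have h7 : inner ℂ u' ξ = (inner ℂ u' ξ).re := by
    apply Complex.ext
    · simp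
    · simpa using h4
  refine ⟨((inner ℂ u' ξ).re - (inner ℂ u ξ).im) / ‖ξ‖ ^ 2, ?_⟩
  apply smul_right_injective H hn0
  dsimp only
  rw [smul_smul]
  have h8 : ((‖ξ‖ ^ 2 : ℝ) : ℂ) * (I * (((inner ℂ u' ξ).re - (inner ℂ u ξ).im) / ‖ξ‖ ^ 2 : ℝ))
      = I * inner ℂ u' ξ - inner ℂ u ξ := by
    rw [ofReal_div, mul_left_comm, mul_div_cancel₀ _ hn0, ofReal_sub]
    linear_combination h6 - I * h7
  rw [h8]
  linear_combination (norm := module) h5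

theorem implementer_I_smul_of_orthogonal (hR : IsLocalSkewForm R) (he : ‖e‖ = 1)
    (h0 : R e e = 0) (hξ : inner ℂ e ξ = 0) :
    implementer R e (I • ξ) = I • implementer R e ξ := by
  rcases eq_or_ne ξ 0 with rfl | hne
  · simp
  obtain ⟨r, hr⟩ := hR.exists_implementer_add he h0 hξ
  -- The left side at (1 + i)ξ is 1 - i times the left side at ξ, so (1 - i)r = (1 + i)s with r and
  -- s real, which forces r = 0.
  obtain ⟨s, hs⟩ := hR.exists_implementer_add (ξ := ξ + I • ξ) he h0
    (by rw [inner_add_right, inner_smul_right, hξ, mul_zero, add_zero])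
  rw [smul_add, smul_smul, I_mul_I, neg_one_smul] at hs
  simp only [map_add, map_neg] at hs
  have h1 : ((1 - I) * (I * r) - I * s * (1 + I)) • ξ = 0 := by
    rw [sub_smul, mul_smul, ← hr]
    have h2 : (1 - I) • (implementer R e ξ + I • implementer R e (I • ξ)) =
        implementer R e ξ + implementer R e (I • ξ)
          + I • (implementer R e (I • ξ) + -implementer R e ξ) := by
      match_scalars
      · ring
      · linear_combination -I_mul_I
    rw [h2, hs]
    module
  rw [smul_eq_zero_iff_left hne] at h1
  have h2 := congrArg re h1
  have h3 := congrArg im h1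
  simp at h2 h3
  have h4 : r = 0 := by linarith
  rw [h4, ofReal_zero, mul_zero, zero_smul] at hr
  have := congrArg (fun v => I • v) hr
  simp only [smul_add, smul_smul, I_mul_I, neg_one_smul, smul_zero] at this
  linear_combination (norm := module) -this

end orthogonal

end IsLocalSkewForm

/-! ### Extension from the complement of e to the whole space -/

theorem skewRankTwo_comm (x y : H) : skewRankTwo x y = skewRankTwo y x := by
  rw [skewRankTwo, skewRankTwo, add_comm]

theorem skewRankTwo_add_left (x y z : H) :
    skewRankTwo (x + y) z = skewRankTwo x z + skewRankTwo y z := by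
  ext w
  simp only [add_apply, skewRankTwo_apply, inner_add_left]
  module

theorem skewRankTwo_add_right (x y z : H) :
    skewRankTwo x (y + z) = skewRankTwo x y + skewRankTwo x z := by
  simp only [skewRankTwo_comm x, skewRankTwo_add_left]

theorem skewRankTwo_smul_left (c : ℝ) (x y : H) :
    skewRankTwo (c • x) y = c • skewRankTwo x y := by
  ext w
  simp only [smul_apply, skewRankTwo_apply, ← Complex.coe_smul, inner_smul_left, conj_ofReal]
  module

theorem skewRankTwo_smul_right (c : ℝ) (x y : H) :
    skewRankTwo x (c • y) = c • skewRankTwo x y := by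
  rw [skewRankTwo_comm, skewRankTwo_smul_left, skewRankTwo_comm]

theorem skewRankTwo_I_smul_left (x y : H) :
    skewRankTwo (I • x) y = -skewRankTwo x (I • y) := by
  ext w
  simp only [neg_apply, skewRankTwo_apply, inner_smul_left, conj_I]
  module

/-- Every vector is the sum of a complex multiple of a unit vector and an orthogonal vector. -/
theorem exists_eq_add_orthogonal {e : H} (he : ‖e‖ = 1) (ξ : H) :
    ∃ (a b : ℝ) (η : H), inner ℂ e η = 0 ∧ ξ = a • e + b • I • e + η := by
  refine ⟨(inner ℂ e ξ).re, (inner ℂ e ξ).im, ξ - inner ℂ e ξ • e, ?_, ?_⟩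
  · rw [inner_sub_right, inner_smul_right, inner_self_eq_norm_sq_to_K, he]
    simp
  · have h : inner ℂ e ξ • e = (inner ℂ e ξ).re • e + (inner ℂ e ξ).im • I • e := by
      conv_lhs => rw [← re_add_im (inner ℂ e ξ)]
      rw [add_smul, mul_smul, Complex.coe_smul, Complex.coe_smul]
    rw [← h]
    abel

namespace IsLocalSkewForm

variable {R : H →ₗ[ℝ] H →ₗ[ℝ] (H →L[ℂ] H)} {e : H}

theorem apply_I_smul_self (hR : IsLocalSkewForm R) (x : H) : R x (I • x) = 0 := by
  have h := hR.rot x x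
  rw [hR.symm] at h
  have h2 : (2 : ℝ) • R x (I • x) = 0 := by rw [two_smul]; nth_rw 1 [h]; exact neg_add_cancel _
  exact (smul_eq_zero_iff_right two_ne_zero).1 h2

theorem implementer_smul_add (hR : IsLocalSkewForm R) (h0 : R e e = 0)
    (a b : ℝ) (η : H) :
    implementer R e (a • e + b • I • e + η) = implementer R e η := by
  simp [implementer_apply, h0, hR.apply_I_smul_self]

theorem implementer_I_smul (hR : IsLocalSkewForm R) (he : ‖e‖ = 1) (h0 : R e e = 0) (ξ : H) :
    implementer R e (I • ξ) = I • implementer R e ξ := by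
  obtain ⟨a, b, η, hη, rfl⟩ := exists_eq_add_orthogonal he ξ
  have h : I • (a • e + b • I • e + η) = (-b) • e + a • I • e + I • η := by
    simp only [smul_add, smul_comm I, smul_smul I I, I_mul_I]
    module
  rw [h, hR.implementer_smul_add h0, hR.implementer_smul_add h0,
    hR.implementer_I_smul_of_orthogonal he h0 hη]

theorem diag_eq (hR : IsLocalSkewForm R) (he : ‖e‖ = 1) (h0 : R e e = 0) (ξ : H) :
    R ξ ξ = (2 : ℝ) • skewRankTwo (implementer R e ξ) ξ := by
  obtain ⟨a, b, η, hη, rfl⟩ := exists_eq_add_orthogonal he ξ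
  have hη' : inner ℂ e (I • η) = 0 := by rw [inner_smul_right, hη, mul_zero]
  have h1 : R (I • e) (I • e) = 0 := by
    rw [hR.rot, smul_smul, I_mul_I, neg_one_smul, map_neg, h0, neg_neg]
  have h2 := hR.apply_I_smul_self e
  have h3 : R (I • e) e = 0 := by rw [hR.symm, h2]
  rw [hR.implementer_smul_add h0]
  simp only [map_add, map_smul, LinearMap.add_apply, LinearMap.smul_apply, h0, h1, h2, h3,
    hR.symm η, hR.rot e η, hR.eq_skewRankTwo he h0 hη, hR.eq_skewRankTwo he h0 hη',
    (hR.diag_eq_skewRankTwo he h0 hη).1, skewRankTwo_add_right, skewRankTwo_smul_right,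
    hR.implementer_I_smul he h0, skewRankTwo_I_smul_left]
  module

theorem re_inner_implementer (hR : IsLocalSkewForm R) (he : ‖e‖ = 1) (h0 : R e e = 0) (ξ : H) :
    (inner ℂ (implementer R e ξ) ξ).re = 0 := by
  obtain ⟨a, b, η, hη, rfl⟩ := exists_eq_add_orthogonal he ξ
  have h : inner ℂ (implementer R e η) e = 0 := by
    rw [← inner_conj_symm, hR.inner_implementer he h0 hη, map_zero]
  rw [hR.implementer_smul_add h0]
  simp [← Complex.coe_smul, h, (hR.diag_eq_skewRankTwo he h0 hη).2]

/-- The implementing operator is bounded, being skew-symmetric and everywhere defined. -/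
theorem exists_skew_implementer [CompleteSpace H] (hR : IsLocalSkewForm R) (he : ‖e‖ = 1)
    (h0 : R e e = 0) :
    ∃ b : H →L[ℂ] H, star b = -b ∧
      ∀ x y, R x y = b * skewRankTwo x y - skewRankTwo x y * b := by
  let u : H →ₗ[ℂ] H :=
    { toFun := implementer R e
      map_add' := map_add _
      map_smul' := fun c x => by
        conv_lhs => rw [← re_add_im c]
        conv_rhs => rw [← re_add_im c]
        simp only [add_smul, mul_smul, Complex.coe_smul, map_add, map_smul,
          hR.implementer_I_smul he h0, RingHom.id_apply] }
  -- Over ℂ, a linear map with real quadratic form is symmetric; the Hellinger–Toeplitz theorem then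
  -- gives continuity.
  have hsymm : (I • u).IsSymmetric := by
    rw [LinearMap.isSymmetric_iff_inner_map_self_real]
    intro v
    have h : (inner ℂ (u v) v).re = 0 := hR.re_inner_implementer he h0 v
    rw [LinearMap.smul_apply, inner_smul_left]
    generalize inner ℂ (u v) v = z at h ⊢
    apply Complex.ext <;> simp [h]
  have hskew : ∀ x y, inner ℂ (u x) y = -inner ℂ x (u y) := by
    intro x y
    have h := hsymm x y
    rw [LinearMap.smul_apply, LinearMap.smul_apply, inner_smul_left, inner_smul_right, conj_I] at h
    exact mul_left_cancel₀ I_ne_zero (by linear_combination -h)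
  have hcont : Continuous u := by
    have h : Continuous fun x => (-I) • (I • u) x := hsymm.continuous.const_smul (-I)
    have h2 : (fun x => (-I) • (I • u) x) = u := by
      funext x
      simp [smul_smul]
    rwa [h2] at h
  refine ⟨⟨u, hcont⟩, ?_, ?_⟩
  · rw [ContinuousLinearMap.star_eq_adjoint, eq_comm, ContinuousLinearMap.eq_adjoint_iff]
    intro x y
    simp [hskew]
  · intro x y
    -- Polarization of the diagonal formula.
    have h : R x y = skewRankTwo (u x) y + skewRankTwo x (u y) := by
      have h1 := hR.diag_eq he h0 (x + y)
      have h2 := hR.diag_eq he h0 x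
      have h3 := hR.diag_eq he h0 y
      simp only [map_add, LinearMap.add_apply, hR.symm y x, skewRankTwo_add_left,
        skewRankTwo_add_right] at h1
      change R x y = skewRankTwo (implementer R e x) y + skewRankTwo x (implementer R e y)
      rw [skewRankTwo_comm x]
      linear_combination (norm := module) (1 / 2 : ℝ) • (h1 - h2 - h3)
    rw [h]
    ext z
    have hx := hskew x z
    have hy := hskew y z
    simp only [add_apply, sub_apply, mul_apply_eq_comp, ContinuousLinearMap.coe_mk',
      skewRankTwo_apply, map_smul, map_add, hx, hy]
    module

end IsLocalSkewForm

/-! ### From local derivations to local skew forms -/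

theorem star_skewRankTwo [CompleteSpace H] (x y : H) :
    star (skewRankTwo x y) = -skewRankTwo x y := by
  rw [ContinuousLinearMap.star_eq_adjoint, eq_comm, ContinuousLinearMap.eq_adjoint_iff]
  intro z w
  rw [neg_apply, inner_neg_left, skewRankTwo_inner, neg_neg]

theorem inner_apply_of_star_eq_neg [CompleteSpace H] {b : H →L[ℂ] H} (hb : star b = -b)
    (x y : H) : inner ℂ (b x) y = -inner ℂ x (b y) := by
  rw [← ContinuousLinearMap.adjoint_inner_right, ← ContinuousLinearMap.star_eq_adjoint, hb,
    neg_apply, inner_neg_right]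

section

variable [CompleteSpace H] {V : Type*} [AddCommGroup V] [Module ℝ V] {ι τ : V →ₗ[ℝ] (H →L[ℂ] H)}

/-- A linear map that agrees at each point with an inner derivation by a skew-adjoint operator
gives a local skew form. -/
theorem exists_isLocalSkewForm
    (hloc : ∀ v, ∃ b : H →L[ℂ] H, star b = -b ∧ τ v = b * ι v - ι v * b)
    (hrk : ∀ x y, ∃ v, ι v = skewRankTwo x y) :
    ∃ R : H →ₗ[ℝ] H →ₗ[ℝ] (H →L[ℂ] H), IsLocalSkewForm R ∧
      ∀ v x y, ι v = skewRankTwo x y → τ v = R x y := by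
  have hcongr : ∀ v w, ι v = ι w → τ v = τ w := by
    intro v w h
    obtain ⟨b, -, hb⟩ := hloc (v - w)
    rw [← sub_eq_zero, ← map_sub, hb, map_sub, h, sub_self, mul_zero, zero_mul, sub_self]
  choose r hr using hrk
  let R : H →ₗ[ℝ] H →ₗ[ℝ] (H →L[ℂ] H) := LinearMap.mk₂ ℝ (fun x y => τ (r x y))
    (fun x y z => by
      rw [← map_add]
      exact hcongr _ _ (by simp only [map_add, hr, skewRankTwo_add_left]))
    (fun c x y => by
      rw [← map_smul]
      exact hcongr _ _ (by simp only [map_smul, hr, skewRankTwo_smul_left]))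
    (fun x y z => by
      rw [← map_add]
      exact hcongr _ _ (by simp only [map_add, hr, skewRankTwo_add_right]))
    (fun c x y => by
      rw [← map_smul]
      exact hcongr _ _ (by simp only [map_smul, hr, skewRankTwo_smul_right]))
  have hR : ∀ v x y, ι v = skewRankTwo x y → τ v = R x y := fun v x y h =>
    hcongr _ _ (h.trans (hr x y).symm)
  have hRloc : ∀ x y, ∃ b : H →L[ℂ] H, star b = -b ∧
      R x y = b * skewRankTwo x y - skewRankTwo x y * b := by
    intro x y
    obtain ⟨b, hb, h⟩ := hloc (r x y)
    exact ⟨b, hb, by rw [← hr x y, ← h]; rfl⟩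
  refine ⟨R, ⟨?_, ?_, ?_, ?_, ?_⟩, hR⟩
  · intro x y
    exact hcongr _ _ (by rw [hr, hr, skewRankTwo_comm])
  · intro x y
    rw [← hR (-r x (I • y)) (I • x) y, map_neg]
    · rfl
    · rw [map_neg, hr, skewRankTwo_I_smul_left]
  · intro x y z w
    obtain ⟨b, hb, h⟩ := hRloc x y
    rw [h]
    simp only [sub_apply, mul_apply_eq_comp, inner_sub_left, inner_sub_right,
      inner_apply_of_star_eq_neg hb, skewRankTwo_inner]
    ring
  · intro x
    obtain ⟨b, hb, h⟩ := hRloc x x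
    rw [h]
    ext z
    simp only [add_apply, sub_apply, smul_apply, mul_apply_eq_comp, skewRankTwo_apply,
      rankOne_apply, map_add, map_smul, inner_smul_right, inner_add_right, inner_sub_right,
      inner_self_eq_norm_sq_to_K (𝕜 := ℂ) x, ← Complex.coe_smul]
    push_cast
    module
  · intro x y hxy
    have hyx : inner ℂ y x = 0 := by rw [← inner_conj_symm, hxy, map_zero]
    -- Both x and y are eigenvectors of this combination with the same eigenvalue 2i‖x‖²‖y‖², so its
    -- commutator with b has no matrix entry between them.
    obtain ⟨b, hb, h⟩ := hloc (‖y‖ ^ 2 • r x x + ‖x‖ ^ 2 • r y y)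
    have h' := congrArg (fun A : H →L[ℂ] H => inner ℂ y (A x)) h
    simp only [map_add, map_smul, hr] at h'
    change inner ℂ y ((‖y‖ ^ 2 • R x x + ‖x‖ ^ 2 • R y y) x) = _ at h'
    simp only [add_apply, sub_apply, smul_apply, mul_apply_eq_comp, skewRankTwo_apply,
      map_add, map_smul, inner_smul_right, inner_add_right, inner_sub_right,
      inner_self_eq_norm_sq_to_K (𝕜 := ℂ), ← Complex.coe_smul, hyx] at h'
    rw [h']
    simp
    ring

/-- A local derivation by skew-adjoint operators is implemented by a single operator on the
elements of rank at most two. -/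
theorem exists_implementer_of_local [Nontrivial H]
    (hloc : ∀ v, ∃ b : H →L[ℂ] H, star b = -b ∧ τ v = b * ι v - ι v * b)
    (hrk : ∀ x y, ∃ v, ι v = skewRankTwo x y) :
    ∃ b : H →L[ℂ] H, star b = -b ∧
      ∀ v x y, ι v = skewRankTwo x y → τ v = b * ι v - ι v * b := by
  obtain ⟨e, he⟩ := exists_norm_eq H zero_le_one
  obtain ⟨v₀, hv₀⟩ := hrk e e
  obtain ⟨b₀, hb₀, hτ₀⟩ := hloc v₀
  -- Normalization: τ' is still local and vanishes at S(e, e).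
  let τ' : V →ₗ[ℝ] (H →L[ℂ] H) :=
    τ - (LinearMap.mulLeft ℝ b₀ - LinearMap.mulRight ℝ b₀) ∘ₗ ι
  have hτ' : ∀ v, τ' v = τ v - (b₀ * ι v - ι v * b₀) := fun v => rfl
  obtain ⟨R, hR, hRv⟩ := exists_isLocalSkewForm (ι := ι) (τ := τ') (fun v => by
    obtain ⟨b, hb, h⟩ := hloc v
    refine ⟨b - b₀, by rw [star_sub, hb, hb₀]; abel, ?_⟩
    rw [hτ', h, sub_mul, mul_sub]
    abel) hrk
  have h0 : R e e = 0 := by rw [← hRv v₀ e e hv₀, hτ', hτ₀, sub_self]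
  obtain ⟨b, hb, h⟩ := hR.exists_skew_implementer he h0
  refine ⟨b + b₀, by rw [star_add, hb, hb₀]; abel, fun v x y hv => ?_⟩
  have h1 := hRv v x y hv
  rw [hτ', h, ← hv, sub_eq_iff_eq_add] at h1
  rw [h1, add_mul, mul_add]
  abel

end

/-! ### Ultraweak approximation by finite-rank operators -/

section density

open Filter Topology

variable {α : Type*} {l : Filter α}

theorem tendsto_ultraweak_iff {f : α → H →L[ℂ] H} {a : H →L[ℂ] H} :
    Tendsto f l (@nhds _ (ultraweakTopology H) a) ↔
      ∀ ξ η : lp (fun _ : ℕ => H) 2, Tendsto (fun i => ∑' n, inner ℂ (ξ n) (f i (η n))) l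
        (𝓝 (∑' n, inner ℂ (ξ n) (a (η n)))) := by
  simp only [nhds_iInf, tendsto_iInf, nhds_induced, tendsto_comap_iff]
  rfl

theorem tendsto_inner_of_tendsto_ultraweak {f : α → H →L[ℂ] H} {a : H →L[ℂ] H}
    (h : Tendsto f l (@nhds _ (ultraweakTopology H) a)) (x y : H) :
    Tendsto (fun i => inner ℂ x (f i y)) l (𝓝 (inner ℂ x (a y))) := by
  have key : ∀ b : H →L[ℂ] H,
      ∑' n, inner ℂ ((lp.single 2 0 x : lp (fun _ : ℕ => H) 2) n)
        (b ((lp.single 2 0 y : lp (fun _ : ℕ => H) 2) n)) = inner ℂ x (b y) := by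
    intro b
    rw [tsum_eq_single 0]
    · simp
    · intro n hn
      simp [hn]
  have := tendsto_ultraweak_iff.1 h (lp.single 2 0 x) (lp.single 2 0 y)
  simpa only [key] using this

/-- On bounded families weak convergence is ultraweak: the series are dominated by C‖ξₙ‖‖ηₙ‖,
summable by Hölder's inequality. -/
theorem tendsto_ultraweak_of_bounded {f : α → H →L[ℂ] H} {a : H →L[ℂ] H} {C : ℝ}
    (hC : ∀ i x y, ‖inner ℂ x (f i y)‖ ≤ C * (‖x‖ * ‖y‖))
    (h : ∀ x y, Tendsto (fun i => inner ℂ x (f i y)) l (𝓝 (inner ℂ x (a y)))) :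
    Tendsto f l (@nhds _ (ultraweakTopology H) a) := by
  rw [tendsto_ultraweak_iff]
  intro ξ η
  refine tendsto_tsum_of_dominated_convergence (bound := fun n => C * (‖ξ n‖ * ‖η n‖)) ?_
    (fun n => h _ _) (Eventually.of_forall fun i n => hC i _ _)
  exact (lp.summable_mul (by simpa using Real.HolderConjugate.two_two) ξ η).mul_left C

/-- The operator `(a P + P a) / 2` for skew-adjoint `a`, with `P` the projection onto the span of
the orthonormal vectors `v j`, `j ∈ s`. -/
noncomputable def skewTruncation {ι : Type*} (v : ι → H) (a : H →L[ℂ] H) (s : Finset ι) :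
    H →L[ℂ] H :=
  (1 / 2 : ℝ) • ∑ j ∈ s, skewRankTwo (-(I • a (v j))) (v j)

/-- For skew-adjoint a, S(-i a v, v) = a(v ⊗ v*) + (v ⊗ v*)a. This is why the truncation is (aP +
Pa)/2: each summand is itself an S(x, y). -/
theorem inner_skewTruncation [CompleteSpace H] {ι : Type*} (v : ι → H) {a : H →L[ℂ] H}
    (ha : star a = -a) (s : Finset ι) (x y : H) :
    inner ℂ x (skewTruncation v a s y) =
      (1 / 2 : ℂ) * (inner ℂ x (a (∑ j ∈ s, inner ℂ (v j) y • v j)) +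
        inner ℂ x (∑ j ∈ s, inner ℂ (v j) (a y) • v j)) := by
  rw [skewTruncation, smul_apply, ← Complex.coe_smul, inner_smul_right, sum_apply, inner_sum,
    map_sum, inner_sum, inner_sum, ← Finset.sum_add_distrib]
  congr 1
  · simp
  · refine Finset.sum_congr rfl fun j _ => ?_
    rw [skewRankTwo_apply, inner_neg_left, inner_smul_left, inner_apply_of_star_eq_neg ha,
      conj_I, map_smul, ← inner_add_right]
    congr 1
    match_scalars
    · linear_combination -inner ℂ (v j) y * I_mul_I
    · linear_combination -inner ℂ (v j) (a y) * I_mul_I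

theorem norm_sum_inner_smul_le {ι : Type*} {v : ι → H} (hv : Orthonormal ℂ v) (s : Finset ι)
    (x : H) : ‖∑ j ∈ s, inner ℂ (v j) x • v j‖ ≤ ‖x‖ := by
  refine (sq_le_sq₀ (norm_nonneg _) (norm_nonneg _)).1 ?_
  refine le_of_eq_of_le ?_ (hv.sum_inner_products_le x (s := s))
  rw [norm_sq_eq_re_inner (𝕜 := ℂ), hv.inner_sum, map_sum]
  refine Finset.sum_congr rfl fun j _ => ?_
  rw [RCLike.conj_mul]
  norm_cast

theorem tendsto_skewTruncation [CompleteSpace H] {ι : Type*} (v : HilbertBasis ι ℂ H)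
    {a : H →L[ℂ] H} (ha : star a = -a) :
    Tendsto (skewTruncation v a) atTop (@nhds _ (ultraweakTopology H) a) := by
  have hP : ∀ x, Tendsto (fun s : Finset ι => ∑ j ∈ s, inner ℂ (v j) x • v j) atTop (𝓝 x) := by
    intro x
    have := v.hasSum_repr x
    simp only [v.repr_apply_apply] at this
    exact this
  refine tendsto_ultraweak_of_bounded (C := ‖a‖) (fun s x y => ?_) (fun x y => ?_)
  · rw [inner_skewTruncation _ ha, norm_mul]
    have h1 : ‖inner ℂ x (a (∑ j ∈ s, inner ℂ (v j) y • v j))‖ ≤ ‖x‖ * (‖a‖ * ‖y‖) :=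
      (norm_inner_le_norm _ _).trans (by
        gcongr
        exact (a.le_opNorm _).trans (by gcongr; exact norm_sum_inner_smul_le v.orthonormal s y))
    have h2 : ‖inner ℂ x (∑ j ∈ s, inner ℂ (v j) (a y) • v j)‖ ≤ ‖x‖ * (‖a‖ * ‖y‖) :=
      (norm_inner_le_norm _ _).trans (by
        gcongr
        exact (norm_sum_inner_smul_le v.orthonormal s _).trans (a.le_opNorm y))
    have h3 : ‖(1 / 2 : ℂ)‖ = 1 / 2 := by norm_num
    rw [h3]
    refine (mul_le_mul_of_nonneg_left ((norm_add_le _ _).trans (add_le_add h1 h2))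
      (by norm_num)).trans_eq ?_
    ring
  · simp only [inner_skewTruncation _ ha]
    have h1 := ((tendsto_const_nhds (x := x)).inner (𝕜 := ℂ)
      ((a.continuous.tendsto y).comp (hP y)))
    have h2 := ((tendsto_const_nhds (x := x)).inner (𝕜 := ℂ) (hP (a y)))
    have h3 := (h1.add h2).const_mul (1 / 2 : ℂ)
    have h4 : (1 / 2 : ℂ) * (inner ℂ x (a y) + inner ℂ x (a y)) = inner ℂ x (a y) := by ring
    rwa [h4] at h3

variable [CompleteSpace H] {V : Type*} [AddCommGroup V] [Module ℝ V] {ι τ : V →ₗ[ℝ] (H →L[ℂ] H)}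

/-- A local derivation by skew-adjoint operators that is ultraweakly-to-weakly continuous is
implemented by a single skew-adjoint operator. -/
theorem exists_implementer_of_continuous [Nontrivial H]
    (hloc : ∀ v, ∃ b : H →L[ℂ] H, star b = -b ∧ τ v = b * ι v - ι v * b)
    (hrk : ∀ x y, ∃ v, ι v = skewRankTwo x y) (hskew : ∀ v, star (ι v) = -ι v)
    (hcont : ∀ v, Tendsto τ (Filter.comap ι (@nhds _ (ultraweakTopology H) (ι v)))
      (@nhds _ (ultraweakTopology H) (τ v))) :
    ∃ b : H →L[ℂ] H, star b = -b ∧ ∀ v, τ v = b * ι v - ι v * b := by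
  obtain ⟨b, hb, h⟩ := exists_implementer_of_local hloc hrk
  refine ⟨b, hb, fun v => ?_⟩
  choose r hr using hrk
  obtain ⟨w, u, -⟩ := exists_hilbertBasis ℂ H
  let f : Finset w → V := fun s =>
    (1 / 2 : ℝ) • ∑ j ∈ s, r (-(I • ι v (u j))) (u j)
  have hf : ∀ s, ι (f s) = skewTruncation u (ι v) s := fun s => by
    simp only [f, map_smul, map_sum, hr, skewTruncation]
  have hτf : ∀ s, τ (f s) = b * ι (f s) - ι (f s) * b := fun s => by
    simp only [f, map_smul, map_sum, h _ _ _ (hr _ _), Finset.sum_sub_distrib, Finset.mul_sum,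
      Finset.sum_mul, smul_sub, mul_smul_comm, smul_mul_assoc]
  have h1 : Tendsto (fun s => ι (f s)) atTop (@nhds _ (ultraweakTopology H) (ι v)) := by
    simpa only [hf] using tendsto_skewTruncation u (hskew v)
  have h2 : Tendsto (fun s => τ (f s)) atTop (@nhds _ (ultraweakTopology H) (τ v)) :=
    (hcont v).comp (tendsto_comap_iff.2 h1)
  ext y
  refine ext_inner_left ℂ fun x => ?_
  refine tendsto_nhds_unique (tendsto_inner_of_tendsto_ultraweak h2 x y) ?_
  simp only [hτf, sub_apply, mul_apply_eq_comp, inner_sub_right]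
  -- Moving b onto the test vector reduces the commutator to weak limits of the truncations
  -- themselves.
  simp only [← ContinuousLinearMap.adjoint_inner_left b]
  exact (tendsto_inner_of_tendsto_ultraweak h1 _ _).sub
    (tendsto_inner_of_tendsto_ultraweak h1 _ _)

end density

end skewForm

/-! ### Reduction to a fixed point of Ω -/

section main

variable {H : Type*} [NormedAddCommGroup H] [InnerProductSpace ℂ H]

theorem isCompactOperator_rankOne (x y : H) : IsCompactOperator (rankOne ℂ x y) := by
  have h : IsCompactOperator (innerSL ℂ y) :=
    isCompactOperator_of_locallyCompactSpace_dom (innerSL ℂ y)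
  exact h.clm_comp (ContinuousLinearMap.toSpanSingleton ℂ x)

theorem isCompactOperator_skewRankTwo (x y : H) : IsCompactOperator (skewRankTwo x y) :=
  ((isCompactOperator_rankOne x y).add (isCompactOperator_rankOne y x)).smul Complex.I

variable [CompleteSpace H]

theorem IsLocalSpatialDerivation.exists_apply_eq {Ω : Type*}
    {L : LieSubalgebra ℝ (Ω → skewOperators H)} {T : L →ₗ[ℝ] L}
    (hT : IsLocalSpatialDerivation T) (x : L) (t : Ω) :
    ∃ b : skewOperators H,
      (T x : Ω → skewOperators H) t = ⁅b, (x : Ω → skewOperators H) t⁆ := by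
  obtain ⟨D, ⟨a, ha⟩, hD⟩ := hT x
  exact ⟨a t, by rw [hD, ha]; rfl⟩

variable {𝒜 : LieSubalgebra ℝ (skewOperators H)} {Ω : Type*} [TopologicalSpace Ω]
  {L : LieSubalgebra ℝ (Ω → skewOperators H)}

theorem exists_coe_eq_skewRankTwo (h𝒜 : 𝒜 = ⊤ ∨ 𝒜 = compactSkewOperators H) (x y : H) :
    ∃ a : 𝒜, ((a : skewOperators H) : H →L[ℂ] H) = skewRankTwo x y := by
  refine ⟨⟨⟨skewRankTwo x y, star_skewRankTwo x y⟩, ?_⟩, rfl⟩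
  rcases h𝒜 with rfl | rfl
  · trivial
  · exact isCompactOperator_skewRankTwo x y

theorem apply_mem (hL : L = allMaps Ω 𝒜 ∨ L = continuousMaps Ω 𝒜) (x : L) (t : Ω) :
    (x : Ω → skewOperators H) t ∈ 𝒜 := by
  obtain ⟨x, hx⟩ := x
  rcases hL with rfl | rfl
  · exact hx t
  · exact hx.2 t

/-- A local spatial derivation is determined at `t` by its values on constant maps. -/
theorem IsLocalSpatialDerivation.apply_eq_evalNablaConst
    (hL : L = allMaps Ω 𝒜 ∨ L = continuousMaps Ω 𝒜) {T : L →ₗ[ℝ] L}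
    (hT : IsLocalSpatialDerivation T) (x : L) (t : Ω) :
    (T x : Ω → skewOperators H) t =
      evalNablaConst hL T t ⟨(x : Ω → skewOperators H) t, apply_mem hL x t⟩ := by
  set c : L := ⟨constMap Ω ((x : Ω → skewOperators H) t),
    constMap_mem hL ⟨(x : Ω → skewOperators H) t, apply_mem hL x t⟩⟩
  -- Locality is applied at x - c, whose value at t is 0.
  obtain ⟨b, hb⟩ := hT.exists_apply_eq (x - c) t
  have h0 : ((x - c : L) : Ω → skewOperators H) t = 0 :=
    sub_self ((x : Ω → skewOperators H) t)
  rw [h0, lie_zero, map_sub] at hb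
  exact sub_eq_zero.1 hb

theorem exists_implementer_at (hH : ¬ FiniteDimensional ℂ H)
    (h𝒜 : 𝒜 = ⊤ ∨ 𝒜 = compactSkewOperators H)
    (hL : L = allMaps Ω 𝒜 ∨ L = continuousMaps Ω 𝒜) {T : L →ₗ[ℝ] L}
    (hT : IsLocalSpatialDerivation T) (t : Ω)
    (hcont : IsUltraweaklyContinuous (evalNablaConst hL T t)) :
    ∃ b : skewOperators H, ∀ x : L,
      (T x : Ω → skewOperators H) t = ⁅b, (x : Ω → skewOperators H) t⁆ := by
  have : Nontrivial H := by
    by_contra h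
    rw [not_nontrivial_iff_subsingleton] at h
    exact hH inferInstance
  let ι : 𝒜 →ₗ[ℝ] (H →L[ℂ] H) :=
    { toFun := fun a => ((a : skewOperators H) : H →L[ℂ] H)
      map_add' := fun _ _ => rfl
      map_smul' := fun _ _ => rfl }
  let ψ : 𝒜 →ₗ[ℝ] L :=
    { toFun := fun a => ⟨constMap Ω (a : skewOperators H), constMap_mem hL a⟩
      map_add' := fun _ _ => rfl
      map_smul' := fun _ _ => rfl }
  let φ : L →ₗ[ℝ] (H →L[ℂ] H) :=
    { toFun := fun x => ((x : Ω → skewOperators H) t : H →L[ℂ] H)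
      map_add' := fun _ _ => rfl
      map_smul' := fun _ _ => rfl }
  obtain ⟨b, hb, h⟩ := exists_implementer_of_continuous (ι := ι) (τ := φ ∘ₗ T ∘ₗ ψ)
    (fun a => by
      obtain ⟨b, hb⟩ := hT.exists_apply_eq (ψ a) t
      exact ⟨b, b.2, congrArg Subtype.val hb⟩)
    (exists_coe_eq_skewRankTwo h𝒜) (fun a => (a : skewOperators H).2)
    (fun a => by
      have h1 : @Continuous 𝒜 (H →L[ℂ] H) (.induced ι (ultraweakTopology H))
          (ultraweakTopology H) (φ ∘ₗ T ∘ₗ ψ) :=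
        @Continuous.comp _ _ _ (_) (.induced Subtype.val (ultraweakTopology H))
          (ultraweakTopology H) _ _
          (@continuous_induced_dom _ _ Subtype.val (ultraweakTopology H)) hcont
      have h2 := @Continuous.tendsto 𝒜 (H →L[ℂ] H) (.induced ι (ultraweakTopology H))
        (ultraweakTopology H) _ h1 a
      rwa [@nhds_induced _ _ (ultraweakTopology H)] at h2)
  refine ⟨⟨b, hb⟩, fun x => ?_⟩
  rw [hT.apply_eq_evalNablaConst hL]
  exact Subtype.ext (h ⟨_, apply_mem hL x t⟩)

end main

theorem mainTheorem4 {H : Type*} [NormedAddCommGroup H] [InnerProductSpace ℂ H] [CompleteSpace H]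
    [TopologicalSpace.SeparableSpace H] (hH : ¬ FiniteDimensional ℂ H)
    {Ω : Type*} [TopologicalSpace Ω]
    (𝒜 : LieSubalgebra ℝ (skewOperators H)) (h𝒜 : 𝒜 = ⊤ ∨ 𝒜 = compactSkewOperators H)
    (L : LieSubalgebra ℝ (Ω → skewOperators H))
    (hL : L = allMaps Ω 𝒜 ∨ L = continuousMaps Ω 𝒜)
    (T : L →ₗ[ℝ] L) (hT : IsLocalSpatialDerivation T)
    (hcont : ∀ t : Ω, IsUltraweaklyContinuous (evalNablaConst hL T t)) :
    ∃ D : LieDerivation ℝ L L, IsSpatialDerivation D ∧ ∀ x : L, T x = D x := by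
  -- The implementers at different t are chosen independently: b may be any map Ω → B_sk(H), so no
  -- continuity in t is required.
  choose b hb using fun t => exists_implementer_at hH h𝒜 hL hT t (hcont t)
  have hT' : ∀ x : L, (T x : Ω → skewOperators H) = ⁅b, (x : Ω → skewOperators H)⁆ :=
    fun x => funext fun t => hb t x
  refine ⟨⟨T, fun x y => Subtype.ext ?_⟩, ⟨b, hT'⟩, fun _ => rfl⟩
  change ((T ⁅x, y⁆ : L) : Ω → skewOperators H) =
    ((⁅x, T y⁆ : L) : Ω → skewOperators H) - ((⁅y, T x⁆ : L) : Ω → skewOperators H)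
  rw [LieSubalgebra.coe_bracket, LieSubalgebra.coe_bracket, hT', hT', hT',
    LieSubalgebra.coe_bracket, leibniz_lie, ← lie_skew (y : Ω → skewOperators H), sub_neg_eq_add,
    add_comm]
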